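/- **Setting.** There are $m$ items and $n$ buyers. A valuation is a function $v:2^{[m]}\to\mathbb{R}_{\ge 0}$; it is *subadditive* if $v(\emptyset)=0$ and $v(S\cup T)\le v(S)+v(T)$ for all $S,T\subseteq[m]$. Buyer $i$ draws $v_i$ from a probability distribution $\mathcal{D}_i$, independently of the other buyers, and $\mathcal{D}=\mathcal{D}_1\times\cdots\times\mathcal{D}_n$. An item pricing is a vector $p\in[0,\infty]^m$ (price $\infty$ means "not for sale"), with $p(T)=\sum_{j\in T}p_j$. When the items of $S$ are offered at prices $p$, a buyer with valuation $v$ purchases a set $T\subseteq S$ that maximizes $v(T)-p(T)$ and that, among the maximizers, has maximal price; remaining ties are resolved by an arbitrary fixed (measurable) rule. For $S=[m]$ write $\mathrm{Alloc}(v,p)$ for the purchased set. *Ex ante item pricing revenue.* For $x\in\mathbb{R}_{\ge0}^m$ let $\mathrm{Rev}_x(\mathcal{D}_i)$ be the supremum of $\mathbb{E}_{p,\,v\sim\mathcal{D}_i}[p(\mathrm{Alloc}(v,p))]$ over all random item pricings $p$, independent of $v$, with $\Pr_{p,\,v\sim\mathcal{D}_i}[j\in\mathrm{Alloc}(v,p)]\le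 x_j$ for all $j\in[m]$. Let $$\mathrm{EARev}(\mathcal{D})=\sup\Big\{\sum_{i=1}^n\mathrm{Rev}_{x_i}(\mathcal{D}_i)\;:\;x_1,\dots,x_n\in\mathbb{R}^m_{\ge0},\ \sum_{i=1}^n x_{ij}\le1\ \text{for all } j\in[m]\Big\}.$$ *Sequential item pricing.* A sequential item pricing mechanism draws a random seed, independent of the valuations, and treats the buyers in the order $1,\dots,n$. It offers buyer $i$ the set $S_i$ of items not sold to buyers $1,\dots,i-1$ at item prices that may depend on the seed, on $S_i$ and on $v_1,\dots,v_{i-1}$; the buyer purchases as above and pays the price of the purchased set. Its revenue $\mathrm{Rev}(\mathcal{D},M)$ is the expected sum of the payments, and $\mathrm{Rev}(\mathcal{D},\mathrm{SeqItemPricing})=\sup_M\mathrm{Rev}(\mathcal{D},M)$. **Theorem.** There is an absolute constant $C>0$ such that for all $n$, $m$ and every product distribution $\mathcal{D}=\mathcal{D}_1\times\cdots\times\mathcal{D}_n$ over subadditive valuations on $m$ items, $$\mathrm{EARev}(\mathcal{D})\;\le\;C\log(m+1)\cdot\mathrm{Rev}(\mathcal{D},\mathrm{SeqItemPricing}),$$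 and moreover some sequential item pricing mechanism $M$ satisfies $\mathrm{EARev}(\mathcal{D})\le C\log(m+1)\cdot\mathrm{Rev}(\mathcal{D},M)$. (For $m\ge2$ the factor is $O(\log m)$.) -/

import Mathlib

open MeasureTheory
open scoped NNReal ENNReal

noncomputable section

namespace Pricing

/-- A combinatorial valuation: a nonnegative value for every bundle of the `m` items. -/
abbrev Valuation (m : ℕ) : Type := Finset (Fin m) → ℝ≥0

/-- Subadditive valuations, with the usual normalization that the empty bundle has value `0`. -/
def IsSubadditive {m : ℕ} (v : Valuation m) : Prop :=
  v ∅ = 0 ∧ ∀ S T : Finset (Fin m), v (S ∪ T) ≤ v S + v T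

/-- A (deterministic) item pricing. The price `∞` means that the item is not for sale. -/
abbrev ItemPrices (m : ℕ) : Type := Fin m → ℝ≥0∞

/-- Additive extension of an item pricing to bundles. -/
def price {m : ℕ} (p : ItemPrices m) (T : Finset (Fin m)) : ℝ≥0∞ := ∑ j ∈ T, p j

/-- Quasilinear utility `v(T) - p(T)`; it is `-∞` when `T` contains an item of price `∞`. -/
def util {m : ℕ} (v : Valuation m) (p : ItemPrices m) (T : Finset (Fin m)) : EReal :=
  ((v T : ℝ≥0∞) : EReal) - (price p T : EReal)

/-- `T` is a bundle that a buyer with valuation `v` may purchase when the items of `S` are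
available at prices `p`: it maximizes the utility among all bundles of available items and,
among all the maximizers, it has maximal price. -/
def IsFavorite {m : ℕ} (S : Finset (Fin m)) (p : ItemPrices m) (v : Valuation m)
    (T : Finset (Fin m)) : Prop :=
  T ⊆ S ∧ (∀ T' ⊆ S, util v p T' ≤ util v p T) ∧
    ∀ T' ⊆ S, util v p T' = util v p T → price p T' ≤ price p T

/-- A way in which buyers resolve the remaining ties: `alloc S p v` is the bundle purchased by a
buyer with valuation `v` when the items of `S` are offered at prices `p`. -/
structure TieBreaking (m : ℕ) where
  alloc : Finset (Fin m) → ItemPrices m → Valuation m → Finset (Fin m)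
  isFavorite : ∀ S p v, IsFavorite S p v (alloc S p v)
  measurable : ∀ S T, MeasurableSet {z : ItemPrices m × Valuation m | alloc S z.1 z.2 = T}

section ExAnte

variable {m : ℕ} (τ : TieBreaking m)

/-- The probability that a buyer with value distribution `D` purchases item `j` when all items
are offered at prices `p`. -/
def allocProb (D : Measure (Valuation m)) (p : ItemPrices m) (j : Fin m) : ℝ≥0∞ :=
  D {v | j ∈ τ.alloc Finset.univ p v}

/-- The expected revenue of the item pricing `p` from a buyer with value distribution `D`. -/
def revenue (D : Measure (Valuation m)) (p : ItemPrices m) : ℝ≥0∞ :=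
  ∫⁻ v, price p (τ.alloc Finset.univ p v) ∂D

/-- A random item pricing satisfies the ex ante constraint `x` over `D`. -/
def SatisfiesExAnte (D : Measure (Valuation m)) (x : Fin m → ℝ≥0)
    (P : ProbabilityMeasure (ItemPrices m)) : Prop :=
  ∀ j, ∫⁻ p, allocProb τ D p j ∂(P : Measure (ItemPrices m)) ≤ x j

/-- The optimal revenue of random item pricings from one buyer under the ex ante
constraint `x`. -/
def exAnteRevBuyer (D : Measure (Valuation m)) (x : Fin m → ℝ≥0) : ℝ≥0∞ :=
  ⨆ (P : ProbabilityMeasure (ItemPrices m)) (_ : SatisfiesExAnte τ D x P),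
    ∫⁻ p, revenue τ D p ∂(P : Measure (ItemPrices m))

/-- The optimal ex ante item pricing revenue from `n` independent buyers. -/
def EARev {n : ℕ} (D : Fin n → Measure (Valuation m)) : ℝ≥0∞ :=
  ⨆ (x : Fin n → Fin m → ℝ≥0) (_ : ∀ j, ∑ i, x i j ≤ 1), ∑ i, exAnteRevBuyer τ (D i) (x i)

end ExAnte

/-- A (randomized, adaptive) sequential item pricing mechanism for buyers arriving in the order
`0, 1, …, n - 1`. The mechanism draws a random seed, independently of the valuations. The prices
offered to buyer `i` depend on the seed, the valuations of the buyers before `i`, and the set of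
items that are still available. -/
structure SeqItemPricing (n m : ℕ) where
  Seed : Type
  [seedSpace : MeasurableSpace Seed]
  law : ProbabilityMeasure Seed
  offer : (i : Fin n) → Seed → (Set.Iio i → Valuation m) → Finset (Fin m) → ItemPrices m
  measurable_offer : ∀ i S,
    Measurable fun z : Seed × (Set.Iio i → Valuation m) => offer i z.1 z.2 S

attribute [instance] SeqItemPricing.seedSpace

namespace SeqItemPricing

variable {n m : ℕ} (M : SeqItemPricing n m) (τ : TieBreaking m)

/-- The prices offered to buyer `i` if the set `S` of items is available. -/
def prices (ω : M.Seed) (v : Fin n → Valuation m) (i : Fin n) (S : Finset (Fin m)) :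
    ItemPrices m :=
  M.offer i ω (fun k => v k.1) S

/-- The set of items that are left after the mechanism has interacted with the first `t`
buyers. -/
def available (ω : M.Seed) (v : Fin n → Valuation m) : ℕ → Finset (Fin m)
  | 0 => Finset.univ
  | t + 1 =>
    if h : t < n then
      available ω v t \
        τ.alloc (available ω v t) (M.prices ω v ⟨t, h⟩ (available ω v t)) (v ⟨t, h⟩)
    else available ω v t

/-- The payment of buyer `i`. -/
def payment (ω : M.Seed) (v : Fin n → Valuation m) (i : Fin n) : ℝ≥0∞ :=
  price (M.prices ω v i (M.available τ ω v i))
    (τ.alloc (M.available τ ω v i) (M.prices ω v i (M.available τ ω v i)) (v i))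

/-- The expected revenue, over the mechanism's seed and the independent valuations. -/
def rev (D : Fin n → Measure (Valuation m)) : ℝ≥0∞ :=
  ∫⁻ z, ∑ i, M.payment τ z.1 z.2 i ∂((M.law : Measure M.Seed).prod (Measure.pi D))

end SeqItemPricing

/-- The optimal revenue of sequential item pricing mechanisms. -/
def seqRev {n m : ℕ} (τ : TieBreaking m) (D : Fin n → Measure (Valuation m)) : ℝ≥0∞ :=
  ⨆ M : SeqItemPricing n m, M.rev τ D

end Pricing

end

noncomputable section

namespace Pricing

/-! ### Inequalities for utility-maximizing bundles -/

section Favorite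

variable {m : ℕ} {S T T' : Finset (Fin m)} {p : ItemPrices m} {v : Valuation m}

/-! Up to a factor 4, the benchmark is the revenue R of pricings P_i that meet ex ante constraints
x_i; an infinite benchmark is matched by a mixture of pricings for one buyer. To post prices
sequentially, keep every item j above a floor r_j. Then depletion is harmless
(`exists_rev_ge_of_floor`): a sold item has earned its floor, and an item left at the end was
available to every buyer. So it is enough that, for every set S, the floors outside S plus a
monotone lower bound on the revenue obtainable from S add up to a large amount.

Split payments at 4mR. If the large ones carry half of R, use the floor R throughout: one sale
suffices, and until then all items are available at p/2 + R, which still brings a quarter of each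
large payment.

Otherwise let V_j be the revenue of item j from small payments and discard sales of j below b_j =
(V_j + R/m)/8. Since j is sold at most once in expectation, this loses at most the sum of the b_j,
which is at most R/4. A buyer facing a depleted set may choose quite different items, but offer the
scalings 2^k p/2 on the retained items G. For a former purchase T, the utility at scale 1/2 is at
least p(T ∩ G)/2 by subadditivity. Either the top scale still sells, or the utility drops to 0 along
the scales, each drop being at most the payment at the lower scale. Retained prices are at least
R/(8m), so O(log m) scales suffice and the best one loses only this factor
(`IsFavorite.price_inter_le_sum_scaledPrices`). -/

theorem price_mono (p : ItemPrices m) (h : T' ⊆ T) : price p T' ≤ price p T :=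
  Finset.sum_le_sum_of_subset h

theorem price_mul (c : ℝ≥0∞) (p : ItemPrices m) (T : Finset (Fin m)) :
    price (fun j => c * p j) T = c * price p T := by
  simp [price, Finset.mul_sum]

theorem le_price_of_mem {j : Fin m} (p : ItemPrices m) (h : j ∈ T) : p j ≤ price p T :=
  Finset.single_le_sum (f := p) (fun _ _ => zero_le) h

theorem IsFavorite.price_ne_top (h : IsFavorite S p v T) : price p T ≠ ∞ := by
  intro htop
  have h0 := h.2.1 ∅ (Finset.empty_subset _)
  rw [util, util, htop, EReal.coe_ennreal_top, EReal.sub_top, le_bot_iff] at h0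
  simp only [price, Finset.sum_empty, EReal.coe_ennreal_zero, sub_zero] at h0
  exact EReal.coe_ennreal_ne_bot _ h0

theorem IsFavorite.value_add_price_le (h : IsFavorite S p v T) (hT' : T' ⊆ S) :
    (v T' : ℝ≥0∞) + price p T ≤ v T + price p T' := by
  by_cases h' : price p T' = ∞
  · simp [h']
  have h0 := h.2.1 T' hT'
  have h1 := h.price_ne_top
  unfold util at h0
  lift price p T to ℝ≥0 using h1 with a ha
  lift price p T' to ℝ≥0 using h' with b hb
  have h2 : ((v T' : ℝ) : EReal) - ((b : ℝ) : EReal) ≤ ((v T : ℝ) : EReal) - ((a : ℝ) : EReal) := h0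
  rw [← EReal.coe_sub, ← EReal.coe_sub, EReal.coe_le_coe_iff] at h2
  norm_cast
  rw [← NNReal.coe_le_coe]
  push_cast
  linarith

theorem IsFavorite.ne_top_of_mem (h : IsFavorite S p v T) {j : Fin m} (hj : j ∈ T) :
    p j ≠ ∞ :=
  ne_top_of_le_ne_top h.price_ne_top (le_price_of_mem p hj)

/-- Every part of a favorite bundle of a subadditive buyer is worth its price. -/
theorem IsFavorite.price_le_value_of_subset (h : IsFavorite S p v T) (hv : IsSubadditive v)
    (hT' : T' ⊆ T) : price p T' ≤ v T' := by
  -- Dropping T' saves its price and, by subadditivity, costs at most v T' in value.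
  have h1 := h.value_add_price_le (T' := T \ T') (Finset.sdiff_subset.trans h.1)
  have h2 : v T ≤ v (T \ T') + v T' := by
    have := hv.2 (T \ T') T'
    rwa [Finset.sdiff_union_of_subset hT'] at this
  have h3 : price p (T \ T') + price p T' = price p T := Finset.sum_sdiff hT'
  have h4 := h.price_ne_top
  rw [← h3] at h1 h4
  have h5 : price p (T \ T') ≠ ∞ := fun hh => h4 (by simp [hh])
  have h2' : (v T : ℝ≥0∞) ≤ v (T \ T') + v T' := by exact_mod_cast h2
  have h6 : ((v (T \ T') : ℝ≥0∞) + price p (T \ T')) + price p T' ≤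
      ((v (T \ T') : ℝ≥0∞) + price p (T \ T')) + v T' := by
    calc _ = (v (T \ T') : ℝ≥0∞) + (price p (T \ T') + price p T') := by ring
      _ ≤ v T + price p (T \ T') := h1
      _ ≤ (v (T \ T') + v T') + price p (T \ T') := by gcongr
      _ = _ := by ring
  exact (ENNReal.add_le_add_iff_left (by simp [h5])).1 h6

/-- At half the prices plus a constant `R`, a buyer still pays a quarter of any
sufficiently large previous payment. -/
theorem IsFavorite.price_le_of_halved_add (h : IsFavorite Finset.univ p v T) {R : ℝ≥0∞}
    (hR : R ≠ ∞) {A : Finset (Fin m)}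
    (hA : IsFavorite Finset.univ (fun j => p j / 2 + R) v A) (hlarge : 4 * m * R ≤ price p T) :
    price p T ≤ 4 * price (fun j => p j / 2 + R) A := by
  have hq : ∀ U : Finset (Fin m), price (fun j => p j / 2 + R) U = price p U / 2 + U.card * R := by
    intro U
    simp [price, Finset.sum_add_distrib, ENNReal.div_eq_inv_mul, Finset.mul_sum]
  have hA0 := hA.price_ne_top
  -- Adding the optimality of A at the new prices and of T at the old ones cancels the values:
  -- p(T)/2 ≤ p(A)/2 + |T|R, where |T|R ≤ mR ≤ p(T)/4.
  have h1 := hA.value_add_price_le (T' := T) (Finset.subset_univ _)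
  have h2 := h.value_add_price_le (T' := A) (Finset.subset_univ _)
  have hc : T.card ≤ m := by simpa using Finset.card_le_univ T
  rw [hq] at hA0 h1 ⊢
  rw [hq] at h1
  have hA1 : price p A ≠ ∞ := fun hh => hA0 (by simp [hh, ENNReal.top_div])
  have hT := h.price_ne_top
  lift price p T to ℝ≥0 using hT with a ha
  lift price p A to ℝ≥0 using hA1 with b hb
  lift R to ℝ≥0 using hR
  have e2 : (2 : ℝ≥0∞) = ((2 : ℝ≥0) : ℝ≥0∞) := rfl
  rw [e2, ← ENNReal.coe_div two_ne_zero] at h1 ⊢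
  rw [← ENNReal.coe_div two_ne_zero] at h1
  norm_cast at h1 h2 hlarge ⊢
  rw [← NNReal.coe_le_coe] at h1 h2 hlarge ⊢
  push_cast at h1 h2 hlarge ⊢
  have hc' : (T.card : ℝ) * R ≤ m * R := by gcongr
  have : (0 : ℝ) ≤ A.card * R := by positivity
  linarith

/-- Prices `p` on the items of `G`; the other items are not for sale. -/
def restrictPrices (G : Finset (Fin m)) (p : ItemPrices m) : ItemPrices m :=
  fun j => if j ∈ G then p j else ∞

/-- Geometric scalings, starting from one half, of the restriction of `p` to `G`. -/
def scaledPrices (G : Finset (Fin m)) (p : ItemPrices m) (k : ℕ) : ItemPrices m :=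
  fun j => 2 ^ k / 2 * restrictPrices G p j

theorem IsFavorite.subset_of_scaledPrices {G : Finset (Fin m)} {k : ℕ}
    (h : IsFavorite S (scaledPrices G p k) v T) : T ⊆ G := by
  intro j hj
  by_contra hG
  apply h.ne_top_of_mem hj
  simp [scaledPrices, restrictPrices, hG, ENNReal.mul_top]

theorem price_scaledPrices {G : Finset (Fin m)} {k : ℕ} (h : T ⊆ G) :
    price (scaledPrices G p k) T = 2 ^ k / 2 * price p T := by
  rw [show scaledPrices G p k = fun j => 2 ^ k / 2 * restrictPrices G p j from rfl, price_mul]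
  congr 1
  exact Finset.sum_congr rfl fun j hj => by simp [restrictPrices, h hj]

/-- The total payment of a subadditive buyer over all scales recovers a constant fraction of the
price of the part of a favorite bundle that is still offered. -/
theorem IsFavorite.price_inter_le_sum_scaledPrices (hv : IsSubadditive v)
    (h : IsFavorite Finset.univ p v T) {G : Finset (Fin m)} (hG : G ⊆ S) {l : ℝ≥0∞} {K : ℕ}
    (hl : ∀ j ∈ G, l ≤ p j) (hK : price p T ≤ 2 ^ K * l) (A : ℕ → Finset (Fin m))
    (hA : ∀ k, IsFavorite S (scaledPrices G p k) v (A k)) :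
    price p (T ∩ G) ≤ 2 * ∑ k ∈ Finset.range (K + 1), price (scaledPrices G p k) (A k) := by
  have hAG : ∀ k, A k ⊆ G := fun k => (hA k).subset_of_scaledPrices
  -- If the top scale sells anything, that payment alone suffices. Otherwise the utility there is v
  -- ∅ = 0.
  rcases (A K).eq_empty_or_nonempty with hAK | ⟨j, hj⟩
  · have hfin : ∀ k, price p (A k) ≠ ∞ := by
      intro k hk
      apply (hA k).price_ne_top
      rw [price_scaledPrices (hAG k), hk, ENNReal.mul_top]
      simp
    -- Telescoping: the utility at scale 0 is at most that at scale k plus the payments at lower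
    -- scales. Keeping A k when prices double costs exactly one more payment at scale k.
    have key : ∀ k ≤ K, (v (A 0) : ℝ≥0∞) + 2 ^ k / 2 * price p (A k) ≤
        v (A k) + 1 / 2 * price p (A 0) +
          ∑ i ∈ Finset.range k, price (scaledPrices G p i) (A i) := by
      intro k
      induction k with
      | zero => intro _; simp
      | succ k ih =>
        intro hk
        have h1 := ih (by omega)
        have h2 := (hA (k + 1)).value_add_price_le ((hAG k).trans hG)
        rw [price_scaledPrices (hAG _), price_scaledPrices (hAG _)] at h2
        rw [Finset.sum_range_succ, price_scaledPrices (hAG k)]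
        have e : (2 : ℝ≥0∞) ^ (k + 1) / 2 = 2 ^ k / 2 + 2 ^ k / 2 := by
          rw [ENNReal.add_halves, pow_succ, ENNReal.mul_div_cancel_right (by simp) (by simp)]
        have hf : (v (A k) : ℝ≥0∞) + 2 ^ k / 2 * price p (A k) ≠ ∞ := by
          simp [hfin k, ENNReal.mul_eq_top, ENNReal.div_eq_top]
        rw [← ENNReal.add_le_add_iff_left hf]
        calc (v (A k) : ℝ≥0∞) + 2 ^ k / 2 * price p (A k) +
              (v (A 0) + 2 ^ (k + 1) / 2 * price p (A (k + 1)))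
            = (v (A k) + 2 ^ (k + 1) / 2 * price p (A (k + 1))) +
              (v (A 0) + 2 ^ k / 2 * price p (A k)) := by ring
          _ ≤ (v (A (k + 1)) + 2 ^ (k + 1) / 2 * price p (A k)) + (v (A k) + 1 / 2 * price p (A 0) +
              ∑ i ∈ Finset.range k, price (scaledPrices G p i) (A i)) := add_le_add h2 h1
          _ = _ := by rw [e]; ring
    have h1 := key K le_rfl
    -- At half price, T ∩ G leaves utility at least p(T ∩ G)/2, because its value covers its full
    -- price.
    have h2 := (hA 0).value_add_price_le (T' := T ∩ G) (Finset.inter_subset_right.trans hG)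
    rw [price_scaledPrices (hAG _), price_scaledPrices Finset.inter_subset_right] at h2
    have h3 := h.price_le_value_of_subset hv (T' := T ∩ G) Finset.inter_subset_left
    have hle : ∑ i ∈ Finset.range K, price (scaledPrices G p i) (A i) ≤
        ∑ i ∈ Finset.range (K + 1), price (scaledPrices G p i) (A i) :=
      Finset.sum_le_sum_of_subset (by simp)
    have hTf : price p (T ∩ G) ≠ ∞ :=
      ne_top_of_le_ne_top h.price_ne_top (price_mono p Finset.inter_subset_left)
    rw [hAK, hv.1] at h1
    simp only [price, Finset.sum_empty, mul_zero, add_zero, ENNReal.coe_zero, zero_add] at h1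
    refine le_trans ?_ (mul_le_mul_right hle 2)
    change _ ≤ 1 / 2 * price p (A 0) + _ at h1
    by_cases htop : ∑ i ∈ Finset.range K, price (scaledPrices G p i) (A i) = ∞
    · simp [htop]
    simp only [pow_zero] at h2
    change _ ≤ _ + ∑ i ∈ Finset.range K, price (scaledPrices G p i) (A i) at h1
    have hA0 := hfin 0
    lift price p (T ∩ G) to ℝ≥0 using hTf with a
    lift price p (A 0) to ℝ≥0 using hA0 with b
    lift ∑ i ∈ Finset.range K, price (scaledPrices G p i) (A i) to ℝ≥0 using htop with c
    have e2 : (1 : ℝ≥0∞) / 2 = ((1 / 2 : ℝ≥0) : ℝ≥0∞) := by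
      rw [ENNReal.coe_div two_ne_zero]; simp
    rw [e2] at h1 h2
    norm_cast at h1 h2 h3 ⊢
    rw [← NNReal.coe_le_coe] at h1 h2 h3 ⊢
    push_cast at h1 h2 h3 ⊢
    linarith
  · calc price p (T ∩ G) ≤ price p T := price_mono p Finset.inter_subset_left
      _ ≤ 2 ^ K * l := hK
      _ ≤ 2 ^ K * price p (A K) := by
          gcongr
          exact (hl j (hAG K hj)).trans (le_price_of_mem p hj)
      _ = 2 * price (scaledPrices G p K) (A K) := by
          rw [price_scaledPrices (hAG K), ← mul_assoc, ENNReal.mul_div_cancel (by simp) (by simp)]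
      _ ≤ _ := by
          gcongr
          exact Finset.single_le_sum (f := fun k => price (scaledPrices G p k) (A k))
            (fun _ _ => zero_le) (Finset.self_mem_range_succ K)

end Favorite

/-! ### Measurability of purchases and payments -/

section Measurability

variable {m : ℕ} (τ : TieBreaking m)

theorem TieBreaking.measurable_comp_alloc (S : Finset (Fin m))
    {f : Finset (Fin m) → ItemPrices m × Valuation m → ℝ≥0∞} (hf : ∀ T, Measurable (f T)) :
    Measurable fun z : ItemPrices m × Valuation m => f (τ.alloc S z.1 z.2) z := by
  have h : (fun z : ItemPrices m × Valuation m => f (τ.alloc S z.1 z.2) z) =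
      fun z => ∑ T, Set.indicator {z | τ.alloc S z.1 z.2 = T} (f T) z := by
    ext z
    simp [Set.indicator_apply]
  rw [h]
  exact Finset.measurable_fun_sum _ fun T _ => (hf T).indicator (τ.measurable S T)

theorem measurable_price (T : Finset (Fin m)) : Measurable fun p : ItemPrices m => price p T :=
  Finset.measurable_fun_sum _ fun j _ => measurable_pi_apply j

theorem TieBreaking.measurable_price_alloc (S : Finset (Fin m)) :
    Measurable fun z : ItemPrices m × Valuation m => price z.1 (τ.alloc S z.1 z.2) :=
  τ.measurable_comp_alloc S fun T => (measurable_price T).comp measurable_fst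

theorem TieBreaking.measurableSet_alloc_eq (S T : Finset (Fin m)) (p : ItemPrices m) :
    MeasurableSet {v | τ.alloc S p v = T} :=
  measurable_prodMk_left (τ.measurable S T)

end Measurability

/-- Replacing one coordinate by an independent copy does not change the integral. -/
theorem lintegral_pi_eq_lintegral_update {n : ℕ} {X : Type*} [MeasurableSpace X]
    (D : Fin n → Measure X) [∀ i, IsProbabilityMeasure (D i)] (i : Fin n)
    {f : (Fin n → X) → ℝ≥0∞} (hf : Measurable f) :
    ∫⁻ v, f v ∂Measure.pi D = ∫⁻ v, ∫⁻ y, f (Function.update v i y) ∂D i ∂Measure.pi D := by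
  obtain ⟨x⟩ : Nonempty (Fin n → X) := by
    have : Nonempty X := nonempty_of_isProbabilityMeasure (D i)
    infer_instance
  have hg : Measurable fun v => ∫⁻ y, f (Function.update v i y) ∂D i := by
    have h2 : Measurable fun z : (Fin n → X) × X => f (Function.update z.1 i z.2) :=
      hf.comp measurable_update'
    exact h2.lintegral_prod_right'
  rw [lintegral_eq_lmarginal_univ x, lintegral_eq_lmarginal_univ x,
    lmarginal_erase' f hf (Finset.mem_univ i), lmarginal_erase' _ hg (Finset.mem_univ i)]
  simp

/-! ### Posted prices above floors -/

section FloorMechanism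

variable {n m : ℕ} (τ : TieBreaking m) (D : Fin n → Measure (Valuation m))

/-- The expected revenue of the prices `p` on the items of `S`. -/
def revenueOn (D : Measure (Valuation m)) (S : Finset (Fin m)) (p : ItemPrices m) : ℝ≥0∞ :=
  ∫⁻ v, price p (τ.alloc S p v) ∂D

/-- The deterministic mechanism that offers the prices `q i S` to buyer `i` if the items of `S`
are available. -/
def postedPrices (q : Fin n → Finset (Fin m) → ItemPrices m) : SeqItemPricing n m where
  Seed := Unit
  law := ⟨Measure.dirac (), inferInstance⟩
  offer i _ _ S := q i S
  measurable_offer _ _ := measurable_const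

variable (q : Fin n → Finset (Fin m) → ItemPrices m)

/-- The items available after `t` buyers under `postedPrices q`. -/
abbrev remaining (v : Fin n → Valuation m) (t : ℕ) : Finset (Fin m) :=
  (postedPrices q).available τ () v t

theorem remaining_succ (v : Fin n → Valuation m) (i : Fin n) :
    remaining τ q v (i + 1) = remaining τ q v i \
      τ.alloc (remaining τ q v i) (q i (remaining τ q v i)) (v i) := by
  exact dif_pos i.2

theorem remaining_succ_of_le (v : Fin n → Valuation m) {t : ℕ} (h : n ≤ t) :
    remaining τ q v (t + 1) = remaining τ q v t := by
  exact dif_neg (by omega)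

theorem remaining_antitone (v : Fin n → Valuation m) : Antitone (remaining τ q v) := by
  refine antitone_nat_of_succ_le fun t => ?_
  by_cases h : t < n
  · exact (remaining_succ τ q v ⟨t, h⟩).trans_le Finset.sdiff_subset
  · exact (remaining_succ_of_le τ q v (by omega)).le

theorem measurableSet_remaining_eq (t : ℕ) (S : Finset (Fin m)) :
    MeasurableSet {v | remaining τ q v t = S} := by
  induction t generalizing S with
  | zero => exact MeasurableSet.const (Finset.univ = S)
  | succ t ih =>
    by_cases h : t < n
    · have : {v | remaining τ q v (t + 1) = S} =
          ⋃ U, ⋃ T, ⋃ (_ : U \ T = S), {v | remaining τ q v t = U} ∩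
            {v | τ.alloc U (q ⟨t, h⟩ U) (v ⟨t, h⟩) = T} := by
        ext v
        have := remaining_succ τ q v ⟨t, h⟩
        simp only [Set.mem_ofPred_eq, Set.mem_iUnion, Set.mem_inter_iff, exists_prop]
        constructor
        · intro hS
          exact ⟨_, _, this ▸ hS, rfl, rfl⟩
        · rintro ⟨U, T, hS, rfl, rfl⟩
          exact this.trans hS
      rw [this]
      exact .iUnion fun U => .iUnion fun T => .iUnion fun _ => (ih U).inter
        ((τ.measurableSet_alloc_eq U T _).preimage (measurable_pi_apply (⟨t, h⟩ : Fin n)))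
    · have : {v | remaining τ q v (t + 1) = S} = {v | remaining τ q v t = S} := by
        ext v
        simp only [Set.mem_ofPred_eq, remaining_succ_of_le τ q v (not_lt.1 h)]
      rw [this]
      exact ih S

theorem measurable_comp_remaining (t : ℕ) {f : Finset (Fin m) → (Fin n → Valuation m) → ℝ≥0∞}
    (hf : ∀ S, Measurable (f S)) : Measurable fun v => f (remaining τ q v t) v := by
  have h : (fun v => f (remaining τ q v t) v) =
      fun v => ∑ S, Set.indicator {v | remaining τ q v t = S} (f S) v := by
    ext v
    simp [Set.indicator_apply]
  rw [h]
  exact Finset.measurable_fun_sum _ fun S _ => (hf S).indicator (measurableSet_remaining_eq τ q t S)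

theorem remaining_update (v : Fin n → Valuation m) (i : Fin n) (y : Valuation m) {t : ℕ}
    (ht : t ≤ i) : remaining τ q (Function.update v i y) t = remaining τ q v t := by
  induction t with
  | zero => rfl
  | succ t ih =>
    have h1 := remaining_succ τ q v ⟨t, by omega⟩
    have h2 := remaining_succ τ q (Function.update v i y) ⟨t, by omega⟩
    simp only at h1 h2
    rw [h1, h2, ih (by omega), Function.update_of_ne]
    exact fun h => absurd (congrArg Fin.val h) (by simp only; omega)

/-- The payment of buyer `i` under `postedPrices q`. -/
def postedPayment (v : Fin n → Valuation m) (i : Fin n) : ℝ≥0∞ :=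
  price (q i (remaining τ q v i)) (τ.alloc (remaining τ q v i) (q i (remaining τ q v i)) (v i))

theorem measurable_postedPayment (i : Fin n) : Measurable fun v => postedPayment τ q v i := by
  refine measurable_comp_remaining τ q i
    (f := fun S v => price (q i S) (τ.alloc S (q i S) (v i))) fun S => ?_
  exact (τ.measurable_price_alloc S).comp
    (measurable_const.prodMk (measurable_pi_apply i))

variable [∀ i, IsProbabilityMeasure (D i)]

theorem rev_postedPrices :
    (postedPrices q).rev τ D = ∫⁻ v, ∑ i, postedPayment τ q v i ∂Measure.pi D := by
  have hm : Measurable fun z : Unit × (Fin n → Valuation m) => ∑ i, postedPayment τ q z.2 i :=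
    Finset.measurable_fun_sum _ fun i _ => (measurable_postedPayment τ q i).comp measurable_snd
  have h : (postedPrices q).rev τ D = ∫⁻ z : Unit × (Fin n → Valuation m),
      ∑ i, postedPayment τ q z.2 i ∂(Measure.dirac ()).prod (Measure.pi D) := rfl
  rw [h, lintegral_prod _ hm.aemeasurable, lintegral_dirac]

/-- The set met by buyer i is independent of the valuation of i, which may therefore be resampled.
-/
theorem lintegral_postedPayment (i : Fin n) :
    ∫⁻ v, postedPayment τ q v i ∂Measure.pi D =
      ∫⁻ v, revenueOn τ (D i) (remaining τ q v i) (q i (remaining τ q v i)) ∂Measure.pi D := by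
  rw [lintegral_pi_eq_lintegral_update D i (measurable_postedPayment τ q i)]
  simp [postedPayment, remaining_update, revenueOn]

theorem sum_floor_sold_le_sum_payment {r : Fin m → ℝ≥0∞} (hr : ∀ i S j, r j ≤ q i S j)
    (v : Fin n → Valuation m) :
    ∑ j ∈ (remaining τ q v n)ᶜ, r j ≤ ∑ i, postedPayment τ q v i := by
  have key : ∀ t ≤ n, ∑ j ∈ (remaining τ q v t)ᶜ, r j ≤
      ∑ i with i.1 < t, postedPayment τ q v i := by
    intro t
    induction t with
    | zero => intro _; simp [remaining, SeqItemPricing.available]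
    | succ t ih =>
      intro ht
      have h1 : ∑ i with i.1 < t + 1, postedPayment τ q v i =
          postedPayment τ q v ⟨t, ht⟩ + ∑ i with i.1 < t, postedPayment τ q v i := by
        rw [← Finset.sum_insert (by simp)]
        congr 1
        ext i
        simp [Fin.ext_iff]
        omega
      have h2 := remaining_succ τ q v ⟨t, ht⟩
      simp only at h2
      rw [h1, h2]
      set A := τ.alloc (remaining τ q v t) (q ⟨t, ht⟩ (remaining τ q v t)) (v ⟨t, ht⟩) with hA
      have h3 : (remaining τ q v t \ A)ᶜ ⊆ A ∪ (remaining τ q v t)ᶜ := by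
        intro j
        simp only [Finset.mem_compl, Finset.mem_sdiff, Finset.mem_union]
        tauto
      calc ∑ j ∈ (remaining τ q v t \ A)ᶜ, r j ≤ ∑ j ∈ A ∪ (remaining τ q v t)ᶜ, r j :=
            Finset.sum_le_sum_of_subset h3
        _ ≤ ∑ j ∈ A, r j + ∑ j ∈ (remaining τ q v t)ᶜ, r j := by
            rw [← Finset.sum_union_inter]; exact le_self_add
        _ ≤ _ := add_le_add (Finset.sum_le_sum fun j _ => hr _ _ j) (ih (by omega))
  refine (key n le_rfl).trans_eq ?_
  congr 1
  ext i
  simp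

/-- If the revenue from each buyer can be bounded below for every set of available items by prices
above the floors `r`, and the floors of the sold items compensate for what can no longer be earned,
then posting such prices is good on average. -/
theorem exists_rev_ge_of_floor (r : Fin m → ℝ≥0∞) (t : Fin n → Finset (Fin m) → ℝ≥0∞)
    (ht : ∀ i, Monotone (t i))
    (hq : ∀ i S, ∃ p : ItemPrices m, (∀ j, r j ≤ p j) ∧ t i S ≤ revenueOn τ (D i) S p)
    {B : ℝ≥0∞} (hB : ∀ S, B ≤ ∑ j ∈ Sᶜ, r j + ∑ i, t i S) :
    ∃ M : SeqItemPricing n m, B ≤ 2 * M.rev τ D := by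
  choose q hr hq using hq
  refine ⟨postedPrices q, ?_⟩
  -- The revenue is used twice: against the floors of the sold items and against the bounds `t i`.
  rw [rev_postedPrices, two_mul]
  have hmt : ∀ i, Measurable fun v => t i (remaining τ q v n) := fun i =>
    measurable_comp_remaining τ q n fun _ => measurable_const
  calc B = ∫⁻ _, B ∂Measure.pi D := by simp
    _ ≤ ∫⁻ v, (∑ j ∈ (remaining τ q v n)ᶜ, r j + ∑ i, t i (remaining τ q v n)) ∂Measure.pi D :=
        lintegral_mono fun v => hB _
    _ = ∫⁻ v, ∑ j ∈ (remaining τ q v n)ᶜ, r j ∂Measure.pi D +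
        ∫⁻ v, ∑ i, t i (remaining τ q v n) ∂Measure.pi D :=
        lintegral_add_right _ (Finset.measurable_fun_sum _ fun i _ => hmt i)
    _ ≤ _ := by
      refine add_le_add (lintegral_mono fun v => sum_floor_sold_le_sum_payment τ q hr v) ?_
      rw [lintegral_finsetSum _ fun i _ => hmt i,
        lintegral_finsetSum _ fun i _ => measurable_postedPayment τ q i]
      refine Finset.sum_le_sum fun i _ => ?_
      rw [lintegral_postedPayment]
      -- Buyer i meets a superset of the final set, so monotonicity of `t i` applies.
      exact lintegral_mono fun v =>
        (ht i (remaining_antitone τ q v i.2.le)).trans (hq i _)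

end FloorMechanism

/-! ### Revenue from large and from small payments -/

section Bounds

variable {n m : ℕ} (τ : TieBreaking m)

/-- The payment of a buyer if it is at least `c`, and zero otherwise. -/
def largePayment (c : ℝ≥0∞) (p : ItemPrices m) (v : Valuation m) : ℝ≥0∞ :=
  if c ≤ price p (τ.alloc Finset.univ p v) then price p (τ.alloc Finset.univ p v) else 0

/-- The payment of a buyer for item `j` at a price of at least `b`, if the total payment is
below `c`. -/
def smallPayment (c b : ℝ≥0∞) (j : Fin m) (p : ItemPrices m) (v : Valuation m) : ℝ≥0∞ :=
  if j ∈ τ.alloc Finset.univ p v ∧ price p (τ.alloc Finset.univ p v) < c ∧ b ≤ p j then p j else 0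

theorem measurable_largePayment (c : ℝ≥0∞) :
    Measurable fun z : ItemPrices m × Valuation m => largePayment τ c z.1 z.2 := by
  have h := τ.measurable_price_alloc Finset.univ
  exact Measurable.ite (measurableSet_le measurable_const h) h measurable_const

theorem measurable_smallPayment (c b : ℝ≥0∞) (j : Fin m) :
    Measurable fun z : ItemPrices m × Valuation m => smallPayment τ c b j z.1 z.2 := by
  refine τ.measurable_comp_alloc Finset.univ
    (f := fun T z => if j ∈ T ∧ price z.1 T < c ∧ b ≤ z.1 j then z.1 j else 0) fun T => ?_
  have hj : Measurable fun z : ItemPrices m × Valuation m => z.1 j :=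
    (measurable_pi_apply j).comp measurable_fst
  refine Measurable.ite ?_ hj measurable_const
  exact (MeasurableSet.const (j ∈ T)).inter
    ((measurableSet_lt ((measurable_price T).comp measurable_fst) measurable_const).inter
      (measurableSet_le measurable_const hj))

theorem price_eq_largePayment_add_sum (c : ℝ≥0∞) (p : ItemPrices m) (v : Valuation m) :
    price p (τ.alloc Finset.univ p v) =
      largePayment τ c p v + ∑ j, smallPayment τ c 0 j p v := by
  unfold largePayment smallPayment
  split_ifs with h
  · simp [not_lt.2 h]
  · simp only [not_le.1 h, zero_le, and_true, zero_add, Finset.sum_ite_mem, Finset.univ_inter]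
    rfl

/-- After integration the last term becomes b times a sale probability, which the ex ante constraint
controls. -/
theorem smallPayment_le_add_indicator (c b : ℝ≥0∞) (j : Fin m) (p : ItemPrices m)
    (v : Valuation m) : smallPayment τ c 0 j p v ≤ smallPayment τ c b j p v +
      b * Set.indicator {v | j ∈ τ.alloc Finset.univ p v} 1 v := by
  unfold smallPayment
  by_cases h1 : j ∈ τ.alloc Finset.univ p v
  · by_cases h2 : b ≤ p j
    · simp [h1, h2]
    · simp only [h1, h2, Set.indicator, Set.mem_ofPred_eq]
      split_ifs <;> simp_all [le_of_lt]
  · simp [h1]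

theorem smallPayment_anti (c b : ℝ≥0∞) (j : Fin m) (p : ItemPrices m) (v : Valuation m) :
    smallPayment τ c b j p v ≤ smallPayment τ c 0 j p v := by
  unfold smallPayment
  split_ifs <;> simp_all

theorem measurableSet_mem_alloc (p : ItemPrices m) (j : Fin m) :
    MeasurableSet {v | j ∈ τ.alloc Finset.univ p v} := by
  have : {v | j ∈ τ.alloc Finset.univ p v} =
      ⋃ T, ⋃ (_ : j ∈ T), {v | τ.alloc Finset.univ p v = T} := by
    ext v; simp
  rw [this]
  exact .iUnion fun T => .iUnion fun _ => τ.measurableSet_alloc_eq _ T p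

variable (D : Fin n → Measure (Valuation m)) [∀ i, IsProbabilityMeasure (D i)]

/-- With the floor R on all items, the first sale already earns R; as long as there is none, each
buyer faces the full set. -/
theorem exists_rev_ge_of_largePayment (P : Fin n → ProbabilityMeasure (ItemPrices m))
    {R : ℝ≥0∞} (hR : R ≠ ∞)
    (hfin : ∀ i, ∫⁻ p, ∫⁻ v, largePayment τ (4 * m * R) p v ∂D i ∂(P i : Measure (ItemPrices m)) ≠ ∞)
    (hlarge : R ≤ 2 * ∑ i, ∫⁻ p, ∫⁻ v, largePayment τ (4 * m * R) p v ∂D i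
      ∂(P i : Measure (ItemPrices m))) :
    ∃ M : SeqItemPricing n m, R ≤ 16 * M.rev τ D := by
  set H : Fin n → ℝ≥0∞ := fun i =>
    ∫⁻ p, ∫⁻ v, largePayment τ (4 * m * R) p v ∂D i ∂(P i : Measure (ItemPrices m)) with hH
  have h48 : (8 : ℝ≥0∞)⁻¹ * 2 = 4⁻¹ := by
    rw [show (8 : ℝ≥0∞) = 4 * 2 by norm_num, ENNReal.mul_inv (by simp) (by simp), mul_assoc,
      ENNReal.inv_mul_cancel (by simp) (by simp), mul_one]
  have hfloor : ∃ M : SeqItemPricing n m, 8⁻¹ * R ≤ 2 * M.rev τ D := by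
    refine exists_rev_ge_of_floor τ D (fun _ => R)
      (fun i S => if S = Finset.univ then 4⁻¹ * H i else 0) ?_ ?_ ?_
    · intro i S S' hS
      by_cases h : S = Finset.univ
      · subst h
        have : S' = Finset.univ := Finset.univ_subset_iff.1 hS
        simp [this]
      · simp [h]
    · intro i S
      by_cases h : S = Finset.univ
      -- Some deterministic pricing does at least as well as the random one on average.
      · obtain ⟨p, hp⟩ := exists_lintegral_le (hfin i)
        refine ⟨fun j => p j / 2 + R, fun j => le_add_self, ?_⟩
        subst h
        simp only [if_true]
        rw [ENNReal.inv_mul_le_iff (by simp) (by simp), revenueOn, ← lintegral_const_mul' _ _ (by simp)]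
        refine hp.trans (lintegral_mono fun v => ?_)
        unfold largePayment
        split_ifs with h
        · exact (τ.isFavorite _ _ _).price_le_of_halved_add hR (τ.isFavorite _ _ _) h
        · exact zero_le
      -- After a sale nothing more is needed, so nothing is offered.
      · exact ⟨fun _ => ∞, fun _ => le_top, by simp [h]⟩
    · intro S
      by_cases h : S = Finset.univ
      · subst h
        simp only [if_true, ← Finset.mul_sum]
        refine le_add_left ?_
        rw [← h48, mul_assoc]
        gcongr
      · obtain ⟨j, hj⟩ : ∃ j, j ∉ S := by
          by_contra! hh
          exact h (Finset.eq_univ_iff_forall.2 hh)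
        refine le_add_right ?_
        calc 8⁻¹ * R ≤ 1 * R := by
              gcongr
              exact ENNReal.inv_le_one.2 (by norm_num)
          _ = R := one_mul R
          _ ≤ _ := Finset.single_le_sum (f := fun _ => R) (fun _ _ => zero_le) (by simpa using hj)
  obtain ⟨M, hM⟩ := hfloor
  refine ⟨M, ?_⟩
  calc R = 8 * (8⁻¹ * R) := by
        rw [← mul_assoc, ENNReal.mul_inv_cancel (by simp) (by simp), one_mul]
    _ ≤ 8 * (2 * M.rev τ D) := by gcongr
    _ = _ := by ring

/-- Some scale of the prices `p` on the available items that are not too cheap recovers a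
logarithmic fraction of the small payments for these items. -/
theorem exists_scaledPrices_revenueOn_ge {D : Measure (Valuation m)}
    (hD : ∀ᵐ v ∂D, IsSubadditive v) {c l : ℝ≥0∞} {b : Fin m → ℝ≥0∞} {K : ℕ} (hb : ∀ j, l ≤ b j)
    (hK : c ≤ 2 ^ K * l) (p : ItemPrices m) (S : Finset (Fin m)) :
    ∃ k, ∫⁻ v, ∑ j ∈ S, smallPayment τ c (b j) j p v ∂D ≤
      2 * (K + 1) * revenueOn τ D S (scaledPrices {j ∈ S | b j ≤ p j} p k) := by
  set G : Finset (Fin m) := {j ∈ S | b j ≤ p j} with hG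
  obtain ⟨k, -, hk⟩ := Finset.exists_max_image (Finset.range (K + 1))
    (fun k => revenueOn τ D S (scaledPrices G p k)) ⟨0, by simp⟩
  refine ⟨k, ?_⟩
  have hpt : ∀ᵐ v ∂D, ∑ j ∈ S, smallPayment τ c (b j) j p v ≤
      2 * ∑ k ∈ Finset.range (K + 1),
        price (scaledPrices G p k) (τ.alloc S (scaledPrices G p k) v) := by
    filter_upwards [hD] with v hv
    by_cases hc : price p (τ.alloc Finset.univ p v) < c
    · have h1 : ∑ j ∈ S, smallPayment τ c (b j) j p v = price p (τ.alloc Finset.univ p v ∩ G) := by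
        simp only [smallPayment, hc, true_and]
        rw [← Finset.sum_filter, price]
        congr 1
        ext j
        simp only [hG, Finset.mem_filter, Finset.mem_inter]
        tauto
      rw [h1]
      exact (τ.isFavorite _ _ _).price_inter_le_sum_scaledPrices hv (Finset.filter_subset _ _)
        (fun j hj => (hb j).trans (Finset.mem_filter.1 hj).2) (hc.le.trans hK) _
        (fun k => τ.isFavorite _ _ _)
    · simp [smallPayment, hc]
  calc ∫⁻ v, ∑ j ∈ S, smallPayment τ c (b j) j p v ∂D
      ≤ ∫⁻ v, 2 * ∑ k ∈ Finset.range (K + 1),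
        price (scaledPrices G p k) (τ.alloc S (scaledPrices G p k) v) ∂D := lintegral_mono_ae hpt
    _ = 2 * ∑ k ∈ Finset.range (K + 1), revenueOn τ D S (scaledPrices G p k) := by
        rw [lintegral_const_mul' _ _ (by simp), lintegral_finsetSum]
        · rfl
        · intro k _
          exact (τ.measurable_price_alloc S).comp measurable_prodMk_left
    _ ≤ 2 * ∑ _k ∈ Finset.range (K + 1), revenueOn τ D S (scaledPrices G p k) := by
        gcongr with k' hk'
        exact hk k' hk'
    _ = _ := by simp [mul_assoc]

/-- The share V_j in the floor pays for losing item j, and the share R/m bounds retained prices from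
below, hence the number of scales. -/
theorem exists_rev_ge_of_smallPayment (hD : ∀ i, ∀ᵐ v ∂D i, IsSubadditive v)
    (P : Fin n → ProbabilityMeasure (ItemPrices m)) {x : Fin n → Fin m → ℝ≥0}
    (hx : ∀ j, ∑ i, x i j ≤ 1) (hP : ∀ i, SatisfiesExAnte τ (D i) (x i) (P i))
    {R : ℝ≥0∞} (hR : R ≠ ∞) (hm : m ≠ 0) {K : ℕ} (hK : 32 * m ^ 2 ≤ 2 ^ K)
    (hle : ∑ j, ∑ i, ∫⁻ p, ∫⁻ v, smallPayment τ (4 * m * R) 0 j p v ∂D i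
      ∂(P i : Measure (ItemPrices m)) ≤ R)
    (hsmall : R ≤ 2 * ∑ j, ∑ i, ∫⁻ p, ∫⁻ v, smallPayment τ (4 * m * R) 0 j p v ∂D i
      ∂(P i : Measure (ItemPrices m))) :
    ∃ M : SeqItemPricing n m, R ≤ 128 * (K + 1) * M.rev τ D := by
  have hmT : (m : ℝ≥0∞) ≠ ∞ := ENNReal.natCast_ne_top m
  have hm0 : (m : ℝ≥0∞) ≠ 0 := by exact_mod_cast hm
  set V : Fin m → ℝ≥0∞ := fun j => ∑ i, ∫⁻ p, ∫⁻ v, smallPayment τ (4 * m * R) 0 j p v ∂D i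
      ∂(P i : Measure (ItemPrices m)) with hV
  -- Since both V j and R/m sum to at most R, the thresholds sum to at most R/4, half of what the
  -- small payments carry.
  set b : Fin m → ℝ≥0∞ := fun j => 8⁻¹ * (V j + R / m) with hb
  set W : Fin n → Fin m → ℝ≥0∞ := fun i j =>
    ∫⁻ p, ∫⁻ v, smallPayment τ (4 * m * R) (b j) j p v ∂D i ∂(P i : Measure (ItemPrices m)) with hW
  have hVfin : ∀ j, V j ≠ ∞ := fun j => ne_top_of_le_ne_top hR
    ((Finset.single_le_sum (f := V) (fun _ _ => zero_le) (Finset.mem_univ j)).trans hle)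
  have hbfin : ∀ j, b j ≠ ∞ := fun j => ENNReal.mul_ne_top (by simp)
    (ENNReal.add_ne_top.2 ⟨hVfin j, ENNReal.div_ne_top hR hm0⟩)
  have hmeas : ∀ (i : Fin n) (j : Fin m),
      Measurable fun p => ∫⁻ v, smallPayment τ (4 * m * R) (b j) j p v ∂D i :=
    fun i j => (measurable_smallPayment τ _ (b j) j).lintegral_prod_right'
  have hmeas' : ∀ (j : Fin m) (p : ItemPrices m),
      Measurable fun v => smallPayment τ (4 * m * R) (b j) j p v :=
    fun j p => (measurable_smallPayment τ _ (b j) j).comp measurable_prodMk_left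
  have hWV : ∀ j, ∑ i, W i j ≤ V j := fun j => Finset.sum_le_sum fun i _ =>
    lintegral_mono fun p => lintegral_mono fun v => smallPayment_anti τ _ _ j p v
  -- Item j is sold with total probability at most 1, so its sales below b j earn at most b j.
  have hVW : ∀ j, V j ≤ ∑ i, W i j + b j := by
    intro j
    calc V j ≤ ∑ i, (W i j + b j * x i j) := by
          refine Finset.sum_le_sum fun i _ => ?_
          calc ∫⁻ p, ∫⁻ v, smallPayment τ (4 * m * R) 0 j p v ∂D i ∂(P i : Measure (ItemPrices m))
              ≤ ∫⁻ p, (∫⁻ v, smallPayment τ (4 * m * R) (b j) j p v ∂D i +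
                b j * allocProb τ (D i) p j) ∂(P i : Measure (ItemPrices m)) := by
                refine lintegral_mono fun p => ?_
                refine (lintegral_mono fun v =>
                  smallPayment_le_add_indicator τ (4 * m * R) (b j) j p v).trans_eq ?_
                rw [lintegral_add_left (hmeas' j p), lintegral_const_mul' _ _ (hbfin j),
                  lintegral_indicator_one (measurableSet_mem_alloc τ p j)]
                rfl
            _ ≤ W i j + b j * x i j := by
                rw [lintegral_add_left (hmeas i j), lintegral_const_mul' _ _ (hbfin j)]
                gcongr
                exact hP i j
      _ = ∑ i, W i j + b j * ∑ i, (x i j : ℝ≥0∞) := by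
          rw [Finset.sum_add_distrib, Finset.mul_sum]
      _ ≤ ∑ i, W i j + b j * 1 := by
          gcongr
          exact_mod_cast hx j
      _ = _ := by rw [mul_one]
  have hbsum : ∑ j, b j ≤ 4⁻¹ * R := by
    have h1 : ∑ _j : Fin m, R / (m : ℝ≥0∞) = R := by
      simp [ENNReal.mul_div_cancel hm0 hmT]
    have h2 : (4 : ℝ≥0∞)⁻¹ = 8⁻¹ * 2 := by
      rw [show (8 : ℝ≥0∞) = 4 * 2 by norm_num, ENNReal.mul_inv (by simp) (by simp), mul_assoc,
        ENNReal.inv_mul_cancel (by simp) (by simp), mul_one]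
    rw [hb, ← Finset.mul_sum, Finset.sum_add_distrib, h1, h2, mul_assoc, two_mul]
    gcongr
  have hWsum : 4⁻¹ * R ≤ ∑ j, ∑ i, W i j := by
    have h1 : R ≤ 2 * ∑ j, ∑ i, W i j + 2 * (4⁻¹ * R) := by
      refine hsmall.trans ?_
      rw [← mul_add]
      gcongr
      refine (Finset.sum_le_sum fun j _ => hVW j).trans ?_
      rw [Finset.sum_add_distrib]
      gcongr
    have h2 : R = 2 * (4⁻¹ * R) + 2 * (4⁻¹ * R) := by
      rw [← add_mul, ← mul_assoc, show (2 : ℝ≥0∞) + 2 = 4 by norm_num,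
        ENNReal.mul_inv_cancel (by simp) (by simp), one_mul]
    have h3 : 2 * (4⁻¹ * R) ≠ ∞ := by simp [ENNReal.mul_eq_top, hR]
    have h4 := (ENNReal.add_le_add_iff_right h3).1 (h2.symm.le.trans h1)
    exact (ENNReal.mul_le_mul_iff_right (by simp) (by simp)).1 h4
  -- The ratio of the payment cap 4mR to the least retained price R/(8m) is 32m².
  have hKc : 4 * m * R ≤ 2 ^ K * (8⁻¹ * (R / m)) := by
    calc 4 * m * R = (32 * m ^ 2) * (8⁻¹ * (R / m)) := by
          rw [show (32 : ℝ≥0∞) * m ^ 2 * (8⁻¹ * (R / m)) = 4 * m * (8 * 8⁻¹) * (m * (R / m)) by ring,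
            ENNReal.mul_inv_cancel (by simp) (by simp), ENNReal.mul_div_cancel hm0 hmT, mul_one]
      _ ≤ _ := by
          gcongr
          exact_mod_cast hK
  have hWfin : ∀ i j, W i j ≠ ∞ := fun i j => ne_top_of_le_ne_top (hVfin j)
    ((Finset.single_le_sum (f := fun i => W i j) (fun _ _ => zero_le) (Finset.mem_univ i)).trans
      (hWV j))
  have hKT : 2 * ((K : ℝ≥0∞) + 1) ≠ ∞ := by simp [ENNReal.mul_eq_top]
  have hK0 : 2 * ((K : ℝ≥0∞) + 1) ≠ 0 := by simp
  have hfloor : ∃ M : SeqItemPricing n m, (2 * ((K : ℝ≥0∞) + 1))⁻¹ * 8⁻¹ * (4⁻¹ * R) ≤ 2 * M.rev τ D := by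
    -- The floor is halved because the lowest scale is one half.
    refine exists_rev_ge_of_floor τ D (fun j => b j / 2)
      (fun i S => (2 * ((K : ℝ≥0∞) + 1))⁻¹ * ∑ j ∈ S, W i j)
      ?_ ?_ ?_
    · intro i S S' hS
      dsimp only
      gcongr
    · intro i S
      have hsum : ∑ j ∈ S, W i j = ∫⁻ p, ∫⁻ v, ∑ j ∈ S, smallPayment τ (4 * m * R) (b j) j p v ∂D i
          ∂(P i : Measure (ItemPrices m)) := by
        rw [hW, ← lintegral_finsetSum _ fun j _ => hmeas i j]
        refine lintegral_congr fun p => ?_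
        rw [lintegral_finsetSum _ fun j _ => hmeas' j p]
      obtain ⟨p, hp⟩ := exists_lintegral_le (μ := (P i : Measure (ItemPrices m)))
        (hsum ▸ ENNReal.sum_ne_top.2 fun j _ => hWfin i j)
      obtain ⟨k, hk⟩ := exists_scaledPrices_revenueOn_ge τ (hD i) (b := b) (l := 8⁻¹ * (R / m))
        (fun j => by simp only [hb]; gcongr; exact le_add_self) hKc p S
      refine ⟨scaledPrices {j ∈ S | b j ≤ p j} p k, fun j => ?_, ?_⟩
      · simp only [scaledPrices, restrictPrices, Finset.mem_filter]
        split_ifs with h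
        · rw [ENNReal.div_eq_inv_mul, ENNReal.div_eq_inv_mul, mul_assoc]
          gcongr
          exact h.2.trans (le_mul_of_one_le_left zero_le (one_le_pow₀ (by norm_num)))
        · simp [ENNReal.mul_top]
      · rw [ENNReal.inv_mul_le_iff hK0 hKT, hsum]
        exact hp.trans hk
    · intro S
      set κ := (2 * ((K : ℝ≥0∞) + 1))⁻¹ with hκ
      have hκ1 : κ ≤ 2⁻¹ := by
        rw [hκ]
        gcongr
        exact le_mul_of_one_le_right zero_le le_add_self
      -- A sold item has floor b j / 2 ≥ V j / 16, which dominates its share of W; unsold items are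
      -- covered by the scaled prices.
      calc κ * 8⁻¹ * (4⁻¹ * R) ≤ κ * 8⁻¹ * ∑ j, ∑ i, W i j := by gcongr
        _ = ∑ j ∈ Sᶜ, κ * 8⁻¹ * ∑ i, W i j + κ * 8⁻¹ * ∑ j ∈ S, ∑ i, W i j := by
            rw [← Finset.sum_compl_add_sum S, mul_add, Finset.mul_sum]
        _ ≤ ∑ j ∈ Sᶜ, b j / 2 + κ * 1 * ∑ j ∈ S, ∑ i, W i j := by
            gcongr with j hj
            · rw [ENNReal.div_eq_inv_mul, mul_assoc]
              gcongr
              exact mul_le_mul_right ((hWV j).trans le_self_add) _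
            · exact ENNReal.inv_le_one.2 (by norm_num)
        _ = _ := by
            rw [mul_one, Finset.sum_comm, Finset.mul_sum]
  obtain ⟨M, hM⟩ := hfloor
  refine ⟨M, ?_⟩
  calc R = (2 * ((K : ℝ≥0∞) + 1) * (2 * ((K : ℝ≥0∞) + 1))⁻¹) * (8 * 8⁻¹) * (4 * 4⁻¹) * R := by
        rw [ENNReal.mul_inv_cancel hK0 hKT, ENNReal.mul_inv_cancel (by simp) (by simp),
          ENNReal.mul_inv_cancel (by simp) (by simp)]
        simp
    _ = 64 * (K + 1) * ((2 * ((K : ℝ≥0∞) + 1))⁻¹ * 8⁻¹ * (4⁻¹ * R)) := by ring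
    _ ≤ 64 * (K + 1) * (2 * M.rev τ D) := by gcongr
    _ = _ := by ring

end Bounds

/-! ### Infinite benchmark -/

section Unbounded

variable {n m : ℕ} (τ : TieBreaking m)

theorem alloc_top (S : Finset (Fin m)) (v : Valuation m) : τ.alloc S (fun _ => ∞) v = ∅ := by
  by_contra h
  obtain ⟨j, hj⟩ := Finset.nonempty_iff_ne_empty.2 h
  exact (τ.isFavorite S _ v).ne_top_of_mem hj rfl

/-- The geometric distribution on `ℕ` with success probability one half. -/
def geometricHalf : Measure ℕ :=
  Measure.sum fun k => (2⁻¹ : ℝ≥0∞) ^ (k + 1) • Measure.dirac k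

theorem lintegral_geometricHalf (f : ℕ → ℝ≥0∞) :
    ∫⁻ k, f k ∂geometricHalf = ∑' k, 2⁻¹ ^ (k + 1) * f k := by
  simp [geometricHalf, lintegral_sum_measure, lintegral_smul_measure]

instance : IsProbabilityMeasure geometricHalf := by
  constructor
  rw [← lintegral_one, lintegral_geometricHalf]
  simp only [mul_one]
  rw [ENNReal.tsum_geometric_add_one, ENNReal.one_sub_inv_two, inv_inv,
    ENNReal.inv_mul_cancel (by simp) (by simp)]

/-- The mechanism that offers to buyer `i` only, at prices `p k` with a geometrically distributed
index `k`. -/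
def mixtureForBuyer (i : Fin n) (p : ℕ → ItemPrices m) : SeqItemPricing n m where
  Seed := ℕ
  law := ⟨geometricHalf, inferInstance⟩
  offer i' k _ _ := if i' = i then p k else fun _ => ∞
  measurable_offer i' _ := by
    split_ifs
    · exact (measurable_of_countable p).comp measurable_fst
    · exact measurable_const

theorem available_mixtureForBuyer (i : Fin n) (p : ℕ → ItemPrices m) (k : ℕ)
    (v : Fin n → Valuation m) {t : ℕ} (ht : t ≤ i) :
    (mixtureForBuyer i p).available τ k v t = Finset.univ := by
  induction t with
  | zero => rfl
  | succ t ih =>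
    have htn : t < n := by omega
    have h1 : (mixtureForBuyer i p).available τ k v (t + 1) =
        (mixtureForBuyer i p).available τ k v t \
          τ.alloc ((mixtureForBuyer i p).available τ k v t)
            (if (⟨t, htn⟩ : Fin n) = i then p k else fun _ => ∞) (v ⟨t, htn⟩) := dif_pos htn
    have h2 : (⟨t, htn⟩ : Fin n) ≠ i := fun h => absurd (congrArg Fin.val h) (by simp only; omega)
    rw [h1, ih (by omega), if_neg h2, alloc_top, Finset.sdiff_empty]

variable (D : Fin n → Measure (Valuation m)) [∀ i, IsProbabilityMeasure (D i)]

theorem le_rev_mixtureForBuyer (i : Fin n) (p : ℕ → ItemPrices m) :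
    ∑' k, 2⁻¹ ^ (k + 1) * revenue τ (D i) (p k) ≤ (mixtureForBuyer i p).rev τ D := by
  have hpay : ∀ (k : ℕ) (v : Fin n → Valuation m), (mixtureForBuyer i p).payment τ k v i =
      price (p k) (τ.alloc Finset.univ (p k) (v i)) := by
    intro k v
    have h1 := available_mixtureForBuyer τ i p k v le_rfl
    have h2 : (mixtureForBuyer i p).prices k v i Finset.univ = p k := if_pos rfl
    unfold SeqItemPricing.payment
    rw [h1, h2]
  have hm : Measurable fun z : ℕ × (Fin n → Valuation m) =>
      price (p z.1) (τ.alloc Finset.univ (p z.1) (z.2 i)) :=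
    (τ.measurable_price_alloc Finset.univ).comp
      (((measurable_of_countable p).comp measurable_fst).prodMk
        ((measurable_pi_apply i).comp measurable_snd))
  calc ∑' k, 2⁻¹ ^ (k + 1) * revenue τ (D i) (p k)
      = ∫⁻ k, revenue τ (D i) (p k) ∂geometricHalf := (lintegral_geometricHalf _).symm
    _ = ∫⁻ k, ∫⁻ v, price (p k) (τ.alloc Finset.univ (p k) (v i)) ∂Measure.pi D
        ∂geometricHalf := by
        refine lintegral_congr fun k => ?_
        have h := (measurePreserving_eval D i).lintegral_comp
          (f := fun y => price (p k) (τ.alloc Finset.univ (p k) y))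
          ((τ.measurable_price_alloc Finset.univ).comp measurable_prodMk_left)
        exact h.symm
    _ = ∫⁻ z, price (p z.1) (τ.alloc Finset.univ (p z.1) (z.2 i))
        ∂geometricHalf.prod (Measure.pi D) := (lintegral_prod _ hm.aemeasurable).symm
    _ ≤ (mixtureForBuyer i p).rev τ D := by
        refine lintegral_mono fun z => ?_
        rw [← hpay]
        exact Finset.single_le_sum (f := fun i' => (mixtureForBuyer i p).payment τ z.1 z.2 i')
          (fun _ _ => zero_le) (Finset.mem_univ i)

/-- A pricing with revenue above 2^(k+1), used with probability 2^-(k+1), contributes at least 1 for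
each k. Randomization lets one mechanism reach ∞ even if no single pricing does. -/
theorem exists_rev_eq_top (i : Fin n) (h : ⨆ p, revenue τ (D i) p = ∞) :
    ∃ M : SeqItemPricing n m, M.rev τ D = ∞ := by
  have h1 : ∀ k : ℕ, ∃ p, (2 : ℝ≥0∞) ^ (k + 1) < revenue τ (D i) p := fun k =>
    lt_iSup_iff.1 (h ▸ ENNReal.pow_lt_top (by simp))
  choose p hp using h1
  refine ⟨mixtureForBuyer i p, top_le_iff.1 (le_trans ?_ (le_rev_mixtureForBuyer τ D i p))⟩
  calc ∞ = ∑' _ : ℕ, (1 : ℝ≥0∞) := by simp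
    _ ≤ _ := by
      refine ENNReal.tsum_le_tsum fun k => ?_
      calc (1 : ℝ≥0∞) = 2⁻¹ ^ (k + 1) * 2 ^ (k + 1) := by
            rw [← mul_pow, ENNReal.inv_mul_cancel (by simp) (by simp), one_pow]
        _ ≤ _ := by gcongr; exact (hp k).le

theorem exAnteRevBuyer_le_iSup_revenue (D : Measure (Valuation m)) (x : Fin m → ℝ≥0) :
    exAnteRevBuyer τ D x ≤ ⨆ p, revenue τ D p := by
  refine iSup₂_le fun P _ => ?_
  calc _ ≤ ∫⁻ _, ⨆ p, revenue τ D p ∂(P : Measure (ItemPrices m)) :=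
        lintegral_mono fun p => le_iSup (revenue τ D) p
    _ = _ := by simp

theorem exists_rev_eq_top_of_EARev_eq_top (h : EARev τ D = ∞) :
    ∃ M : SeqItemPricing n m, M.rev τ D = ∞ := by
  have h1 : EARev τ D ≤ ∑ i, ⨆ p, revenue τ (D i) p := iSup₂_le fun x _ =>
    Finset.sum_le_sum fun i _ => exAnteRevBuyer_le_iSup_revenue τ (D i) (x i)
  obtain ⟨i, -, hi⟩ := ENNReal.sum_eq_top.1 (top_le_iff.1 (h ▸ h1))
  exact exists_rev_eq_top τ D i hi

end Unbounded

/-! ### Near-optimal ex ante pricings and the final constant -/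

section Main

variable {n m : ℕ} (τ : TieBreaking m)

theorem exists_satisfiesExAnte_revenue_ge (D : Measure (Valuation m)) (x : Fin m → ℝ≥0)
    (h : exAnteRevBuyer τ D x ≠ ∞) :
    ∃ P : ProbabilityMeasure (ItemPrices m), SatisfiesExAnte τ D x P ∧
      exAnteRevBuyer τ D x ≤ 2 * ∫⁻ p, revenue τ D p ∂(P : Measure (ItemPrices m)) := by
  -- Half of a zero supremum is not strictly smaller, so feasibility is shown directly by selling
  -- nothing.
  by_cases h0 : exAnteRevBuyer τ D x = 0
  · refine ⟨⟨Measure.dirac fun _ => ∞, inferInstance⟩, fun j => ?_, by simp [h0]⟩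
    change ∫⁻ p, allocProb τ D p j ∂Measure.dirac (fun _ => ∞) ≤ _
    rw [lintegral_dirac]
    simp [allocProb, alloc_top]
  · have h1 := ENNReal.half_lt_self h0 h
    obtain ⟨P, h2⟩ := lt_iSup_iff.1 (h1.trans_eq rfl)
    obtain ⟨hP, h3⟩ := lt_iSup_iff.1 h2
    refine ⟨P, hP, ?_⟩
    rw [mul_comm]
    exact (ENNReal.div_le_iff (by simp) (by simp)).1 h3.le

variable (D : Fin n → Measure (Valuation m)) [∀ i, IsProbabilityMeasure (D i)]

theorem exists_rev_ge_of_satisfiesExAnte (hD : ∀ i, ∀ᵐ v ∂D i, IsSubadditive v)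
    (P : Fin n → ProbabilityMeasure (ItemPrices m)) {x : Fin n → Fin m → ℝ≥0}
    (hx : ∀ j, ∑ i, x i j ≤ 1) (hP : ∀ i, SatisfiesExAnte τ (D i) (x i) (P i))
    {R : ℝ≥0∞} (hRP : ∑ i, ∫⁻ p, revenue τ (D i) p ∂(P i : Measure (ItemPrices m)) = R)
    (hR : R ≠ ∞) (hm : m ≠ 0) {K : ℕ} (hK : 32 * m ^ 2 ≤ 2 ^ K) :
    ∃ M : SeqItemPricing n m, R ≤ 128 * (K + 1) * M.rev τ D := by
  set c : ℝ≥0∞ := 4 * m * R with hc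
  have hsplit : R = ∑ i, ∫⁻ p, ∫⁻ v, largePayment τ c p v ∂D i ∂(P i : Measure (ItemPrices m)) +
      ∑ j, ∑ i, ∫⁻ p, ∫⁻ v, smallPayment τ c 0 j p v ∂D i ∂(P i : Measure (ItemPrices m)) := by
    rw [Finset.sum_comm, ← Finset.sum_add_distrib, ← hRP]
    refine Finset.sum_congr rfl fun i _ => ?_
    rw [← lintegral_finsetSum _ fun j _ =>
        (measurable_smallPayment τ c 0 j).lintegral_prod_right',
      ← lintegral_add_left (measurable_largePayment τ c).lintegral_prod_right']
    refine lintegral_congr fun p => ?_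
    have hs : ∀ j, Measurable fun v => smallPayment τ c 0 j p v := fun j =>
      (measurable_smallPayment τ c 0 j).comp measurable_prodMk_left
    have hl : Measurable fun v => largePayment τ c p v :=
      (measurable_largePayment τ c).comp measurable_prodMk_left
    rw [← lintegral_finsetSum _ fun j _ => hs j, ← lintegral_add_left hl]
    exact lintegral_congr fun v => price_eq_largePayment_add_sum τ c p v
  set A := ∑ i, ∫⁻ p, ∫⁻ v, largePayment τ c p v ∂D i ∂(P i : Measure (ItemPrices m)) with hA
  set B := ∑ j, ∑ i, ∫⁻ p, ∫⁻ v, smallPayment τ c 0 j p v ∂D i ∂(P i : Measure (ItemPrices m))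
    with hB
  have hAR : A ≤ R := hsplit ▸ le_self_add
  have hBR : B ≤ R := hsplit ▸ le_add_self
  rcases le_total B A with h | h
  · obtain ⟨M, hM⟩ := exists_rev_ge_of_largePayment τ D P hR
      (fun i => ENNReal.sum_ne_top.1 (ne_top_of_le_ne_top hR hAR) i (Finset.mem_univ i))
      (hsplit.le.trans (by rw [two_mul]; gcongr))
    refine ⟨M, hM.trans ?_⟩
    gcongr
    calc (16 : ℝ≥0∞) ≤ 128 * 1 := by norm_num
      _ ≤ _ := by gcongr; exact le_add_self
  · exact exists_rev_ge_of_smallPayment τ D hD P hx hP hR hm hK hBR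
      (hsplit.le.trans (by rw [two_mul]; gcongr))

theorem exists_EARev_le (hD : ∀ i, ∀ᵐ v ∂D i, IsSubadditive v) (hm : m ≠ 0) {K : ℕ}
    (hK : 32 * m ^ 2 ≤ 2 ^ K) :
    ∃ M : SeqItemPricing n m, EARev τ D ≤ 512 * (K + 1) * M.rev τ D := by
  by_cases htop : EARev τ D = ∞
  · obtain ⟨M, hM⟩ := exists_rev_eq_top_of_EARev_eq_top τ D htop
    refine ⟨M, ?_⟩
    rw [hM, ENNReal.mul_top (by simp)]
    exact le_top
  by_cases h0 : EARev τ D = 0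
  · exact ⟨postedPrices fun _ _ _ => ∞, by simp [h0]⟩
  obtain ⟨x, h1⟩ := lt_iSup_iff.1 ((ENNReal.half_lt_self h0 htop).trans_eq rfl)
  obtain ⟨hx, h2⟩ := lt_iSup_iff.1 h1
  have h3 : ∑ i, exAnteRevBuyer τ (D i) (x i) ≤ EARev τ D :=
    le_iSup₂_of_le (f := fun (x : Fin n → Fin m → ℝ≥0) (_ : ∀ j, ∑ i, x i j ≤ 1) =>
      ∑ i, exAnteRevBuyer τ (D i) (x i)) x hx le_rfl
  have h4 := ENNReal.sum_ne_top.1 (ne_top_of_le_ne_top htop h3)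
  choose P hP hrev using fun i => exists_satisfiesExAnte_revenue_ge τ (D i) (x i)
    (h4 i (Finset.mem_univ i))
  have h5 : ∑ i, ∫⁻ p, revenue τ (D i) p ∂(P i : Measure (ItemPrices m)) ≤ EARev τ D :=
    (Finset.sum_le_sum fun i _ => le_iSup₂_of_le (P i) (hP i) le_rfl).trans h3
  obtain ⟨M, hM⟩ := exists_rev_ge_of_satisfiesExAnte τ D hD P hx hP rfl
    (ne_top_of_le_ne_top htop h5) hm hK
  refine ⟨M, ?_⟩
  -- One factor 2 for the choice of x and one for the choice of P: 512 = 2 · 2 · 128.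
  calc EARev τ D ≤ (∑ i, exAnteRevBuyer τ (D i) (x i)) * 2 :=
        (ENNReal.div_le_iff (by simp) (by simp)).1 h2.le
    _ ≤ (2 * ∑ i, ∫⁻ p, revenue τ (D i) p ∂(P i : Measure (ItemPrices m))) * 2 := by
        rw [Finset.mul_sum]
        gcongr with i
        exact hrev i
    _ ≤ (2 * (128 * (K + 1) * M.rev τ D)) * 2 := by gcongr
    _ = _ := by ring

theorem EARev_eq_zero_of_no_items (τ : TieBreaking 0) (D : Fin n → Measure (Valuation 0)) :
    EARev τ D = 0 := by
  simp [EARev, exAnteRevBuyer, revenue, price, Finset.eq_empty_of_isEmpty]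

/-- For m ≥ 1, log(m + 1) ≥ log 2 absorbs the additive constant. -/
theorem log_scales_le {m : ℕ} (hm : m ≠ 0) :
    ((2 * (Nat.log 2 m + 1) + 5 : ℕ) : ℝ) + 1 ≤ 20 * Real.log (m + 1) := by
  have h2 := Real.log_two_gt_d9
  have h1 : (Nat.log 2 m : ℝ) * Real.log 2 ≤ Real.log (m + 1) := by
    rw [← Real.log_pow]
    apply Real.log_le_log (by positivity)
    have := Nat.pow_log_le_self 2 hm
    have : ((2 ^ Nat.log 2 m : ℕ) : ℝ) ≤ m := by exact_mod_cast this
    push_cast at this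
    linarith
  have h3 : Real.log 2 ≤ Real.log (m + 1) := by
    apply Real.log_le_log (by norm_num)
    have : (1 : ℝ) ≤ m := by exact_mod_cast Nat.one_le_iff_ne_zero.2 hm
    linarith
  have h4 : (0 : ℝ) ≤ Nat.log 2 m := by positivity
  push_cast
  nlinarith

end Main

end Pricing

end

theorem theorem1 :
    ∃ C : ℝ, 0 < C ∧
      ∀ (n m : ℕ) (τ : Pricing.TieBreaking m)
        (D : Fin n → MeasureTheory.Measure (Pricing.Valuation m))
        [∀ i, MeasureTheory.IsProbabilityMeasure (D i)],
        (∀ i, ∀ᵐ v ∂(D i), Pricing.IsSubadditive v) →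
          Pricing.EARev τ D ≤ ENNReal.ofReal (C * Real.log (m + 1)) * Pricing.seqRev τ D ∧
          ∃ M : Pricing.SeqItemPricing n m,
            Pricing.EARev τ D ≤ ENNReal.ofReal (C * Real.log (m + 1)) * M.rev τ D := by
  -- 10240 = 512 · 20, with 20 from `log_scales_le`.
  refine ⟨10240, by norm_num, fun n m τ D _ hD => ?_⟩
  have key : ∃ M : Pricing.SeqItemPricing n m,
      Pricing.EARev τ D ≤ ENNReal.ofReal (10240 * Real.log (m + 1)) * M.rev τ D := by
    -- Without items log(m + 1) = 0, so the benchmark itself must vanish.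
    rcases eq_or_ne m 0 with rfl | hm
    · exact ⟨Pricing.postedPrices fun _ _ _ => ⊤, by
        simp [Pricing.EARev_eq_zero_of_no_items]⟩
    have hK : 32 * m ^ 2 ≤ 2 ^ (2 * (Nat.log 2 m + 1) + 5) := by
      have h1 : m ≤ 2 ^ (Nat.log 2 m + 1) := (Nat.lt_pow_succ_log_self (by norm_num) m).le
      calc 32 * m ^ 2 ≤ 32 * (2 ^ (Nat.log 2 m + 1)) ^ 2 := by gcongr
        _ = _ := by rw [← pow_mul, mul_comm (Nat.log 2 m + 1) 2, pow_add 2 _ 5]; ring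
    obtain ⟨M, hM⟩ := Pricing.exists_EARev_le τ D hD hm hK
    refine ⟨M, hM.trans ?_⟩
    gcongr
    have h2 := Pricing.log_scales_le hm
    generalize 2 * (Nat.log 2 m + 1) + 5 = K at h2
    have h3 : (512 * (K + 1) : ENNReal) = ENNReal.ofReal (512 * (K + 1)) := by
      rw [ENNReal.ofReal_mul (by norm_num), ENNReal.ofReal_add (by positivity) (by norm_num)]
      simp
    rw [h3]
    exact ENNReal.ofReal_le_ofReal (by linarith)
  refine ⟨?_, key⟩
  obtain ⟨M, hM⟩ := key
  refine hM.trans ?_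
  gcongr
  exact le_iSup (fun M : Pricing.SeqItemPricing n m => M.rev τ D) M
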